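/- All graphs are finite, undirected, without loops or multiple edges. A subgraph $H$ of a graph $U$ is isometric if $\mathrm{dist}_H(u,v)=\mathrm{dist}_U(u,v)$ for all vertices $u,v$ of $H$. A graph $U$ is isometric-universal for a family $\mathcal F$ of graphs if every graph of $\mathcal F$ is isomorphic to an isometric subgraph of $U$; it is minimum if no isometric-universal graph for $\mathcal F$ has fewer vertices. The pathwidth of a graph $G$ is the smallest integer $p\ge 0$ such that $G$ is a subgraph of some interval graph with maximum clique size $p+1$. For an integer $t$ and $i\in\{1,2,3\}$, the type-$i$ star is the graph obtained from $K_{1,t^i}$ by replacing each edge by a path of length $t^{3-i}$; it has $s=t^3+1$ vertices. Let $T_i$ be obtained from disjoint copies of the type-$i$ star and of the type-$(1+(i \bmod 3))$ star by adding an edge between their centers. Theorem. For every integer $t\ge 9$, each of $T_1,T_2,T_3$ is a tree with $2t^3+2$ vertices and pathwidth two, and no isometric-universal tree for $\{T_1,T_2,T_3\}$ is minimum. More precisely, the graph with $3s$ vertices that consists of disjoint stars of types $1$, $2$ and $3$, together with the three edges between their centers, is isometric-universal for $\{T_1,T_2,T_3\}$, while every isometric-universal tree for $\{T_1,T_2,T_3\}$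 has more than $3s$ vertices. -/

import Mathlib

namespace SimpleGraph

/-- A subgraph `H` of `U` is isometric if distances in `H` and in `U` agree on the vertices of `H`
(the distance between vertices in different components is infinite). -/
def Subgraph.IsIsometric {W : Type*} {U : SimpleGraph W} (H : U.Subgraph) : Prop :=
  ∀ u v : H.verts, H.coe.edist u v = U.edist (u : W) (v : W)

/-- `U` is isometric-universal for the family `F` if every graph of `F` is isomorphic to an
isometric subgraph of `U`. -/
def IsIsometricUniversal {ι : Type*} {V : ι → Type*} {W : Type*}
    (F : (i : ι) → SimpleGraph (V i)) (U : SimpleGraph W) : Prop :=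
  ∀ i, ∃ H : U.Subgraph, H.IsIsometric ∧ Nonempty (F i ≃g H.coe)

/-- A finite isometric-universal graph is minimum if no finite isometric-universal graph for the
same family has fewer vertices. -/
def IsMinimumIsometricUniversal {ι : Type*} {V : ι → Type*} {W : Type*} [Finite W]
    (F : (i : ι) → SimpleGraph (V i)) (U : SimpleGraph W) : Prop :=
  IsIsometricUniversal F U ∧
    ∀ (W' : Type) [Finite W'] (U' : SimpleGraph W'),
      IsIsometricUniversal F U' → Nat.card W ≤ Nat.card W'

/-- An interval graph: the intersection graph of a family of nonempty closed real intervals. -/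
def IsIntervalGraph {V : Type*} (G : SimpleGraph V) : Prop :=
  ∃ l r : V → ℝ, (∀ v, l v ≤ r v) ∧
    ∀ u v, G.Adj u v ↔ u ≠ v ∧ (Set.Icc (l u) (r u) ∩ Set.Icc (l v) (r v)).Nonempty

/-- The pathwidth of a finite graph `G`: the least `p` such that `G` is a subgraph of a finite
interval graph with maximum clique size `p + 1`. -/
noncomputable def pathwidth {V : Type*} [Finite V] (G : SimpleGraph V) : ℕ :=
  sInf {p : ℕ | ∃ (m : ℕ) (H : SimpleGraph (Fin m)),
    H.IsIntervalGraph ∧ G.IsContained H ∧ H.cliqueNum = p + 1}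

/-- The star `K_{1,b}` with each edge replaced by a path of length `l`. The centre is `none`, and
`some (a, j)` is the vertex at distance `j + 1` from the centre on the branch `a`. -/
def subdividedStar (b l : ℕ) : SimpleGraph (Option (Fin b × Fin l)) :=
  SimpleGraph.fromRel fun x y =>
    match x, y with
    | none, some (_, j) => (j : ℕ) = 0
    | some (a, j), some (a', j') => a = a' ∧ (j' : ℕ) = j + 1
    | _, _ => False

end SimpleGraph

namespace ThreeTrees

/-- The vertices of the type-`(k + 1)` star, for `k = 0, 1, 2`. -/
abbrev StarVertex (t : ℕ) (k : Fin 3) : Type :=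
  Option (Fin (t ^ ((k : ℕ) + 1)) × Fin (t ^ (3 - ((k : ℕ) + 1))))

/-- The type-`i` star with `i = k + 1`: the star `K_{1,t^i}` with each edge replaced by a path of
length `t^(3-i)`. -/
def star (t : ℕ) (k : Fin 3) : SimpleGraph (StarVertex t k) :=
  SimpleGraph.subdividedStar (t ^ ((k : ℕ) + 1)) (t ^ (3 - ((k : ℕ) + 1)))

/-- The tree `T_i` with `i = k + 1`: disjoint stars of type `i` and `1 + (i mod 3)`, together with
an edge between their centres. The addition `k + 1` in `Fin 3` is cyclic. -/
def tree (t : ℕ) (k : Fin 3) : SimpleGraph (StarVertex t k ⊕ StarVertex t (k + 1)) :=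
  (star t k ⊕g star t (k + 1)) ⊔ SimpleGraph.edge (Sum.inl none) (Sum.inr none)

/-- Disjoint stars of types 1, 2 and 3, with their three centres made pairwise adjacent. -/
def triangleOfStars (t : ℕ) : SimpleGraph (Σ k : Fin 3, StarVertex t k) where
  Adj x y :=
    (∃ (k : Fin 3) (a b : StarVertex t k), x = ⟨k, a⟩ ∧ y = ⟨k, b⟩ ∧ (star t k).Adj a b) ∨
      (x.1 ≠ y.1 ∧ x.2 = none ∧ y.2 = none)
  symm := ⟨by
    rintro x y (⟨k, a, b, hx, hy, h⟩ | ⟨h, hx, hy⟩)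
    · exact Or.inl ⟨k, b, a, hy, hx, h.symm⟩
    · exact Or.inr ⟨h.symm, hy, hx⟩⟩
  loopless := ⟨by
    rintro x (⟨k, a, b, hx, hy, h⟩ | ⟨h, -, -⟩)
    · subst hx
      obtain rfl : a = b := by simpa using hy
      exact h.ne rfl
    · exact h rfl⟩

end ThreeTrees

/-!
Each tree in question is a pair of subdivided stars with adjacent centres, rooted at one of the
centres. All its distances are given by an explicit formula (`SimpleGraph.doubleStar_edist`), from
which connectedness follows; it is a tree since every edge joins a vertex other than the root to its
parent.

The pathwidth is at most two because the branches of each star can be laid out as a chain of unit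
intervals below one long interval for the centre, the two stars on the two half-lines; the resulting
interval graph has a proper colouring with three colours. It is at least two because one of the two
stars contains the spider with three legs of length two, and an interval graph containing this
spider contains a triangle (`SimpleGraph.IsIntervalGraph.not_cliqueFree_three`).

In the three stars with a triangle on their centres, each of the trees is isometric, since
collapsing the third star to a centre is a retraction onto the tree that does not increase
distances.

For the lower bound, consider an isometric-universal tree. It contains two copies of each type of
star, six in all, whose centres are pairwise adjacent as prescribed by the three trees. If the two
copies of each type always had the same centre, the three centres would form a triangle; so some
type occurs with two different centres (`ThreeTrees.exists_star_copies`). Two stars with different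
centres in a tree meet in at most two branches of either
(`SimpleGraph.IsStarCopy.ncard_inter_le_of_ne`), and two stars with the same centre meet only as far
as the number of branches of one and the length of the branches of the other allow
(`SimpleGraph.IsStarCopy.ncard_inter_le_of_eq`). Thus copies of the three stars and the additional
copy have pairwise intersections of order `t ^ 2`, and by inclusion and exclusion their union has
more than `3 (t ^ 3 + 1)` vertices.
-/

/-! ### Distances in graphs and in subdivided stars -/

namespace SimpleGraph

/-- A function `D` is the distance of `G` as soon as it is `1`-Lipschitz along edges and any two
distinct vertices can be brought one step closer by moving one of them along an edge. -/
lemma edist_eq_of_lipschitz_of_step {V : Type*} {G : SimpleGraph V} {D : V → V → ℕ}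
    (hself : ∀ x, D x x = 0) (hlip : ∀ x y z, G.Adj y z → D x z ≤ D x y + 1)
    (hstep : ∀ x y, x ≠ y → ∃ z, (G.Adj z y ∧ D x z + 1 = D x y) ∨ (G.Adj x z ∧ D z y + 1 = D x y))
    (x y : V) : G.edist x y = D x y := by
  apply le_antisymm
  · obtain ⟨n, hn⟩ : ∃ n, n = D x y := ⟨_, rfl⟩
    rw [← hn]
    induction n generalizing x y with
    | zero =>
      rcases eq_or_ne x y with rfl | hxy
      · simp
      · obtain ⟨z, h | h⟩ := hstep x y hxy <;> omega
    | succ n ih =>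
      have hxy : x ≠ y := by
        rintro rfl
        simp [hself] at hn
      obtain ⟨z, ⟨ha, h⟩ | ⟨ha, h⟩⟩ := hstep x y hxy
      · calc G.edist x y ≤ G.edist x z + G.edist z y := G.edist_triangle
          _ ≤ n + 1 := add_le_add (ih x z (by omega)) (edist_eq_one_iff_adj.2 ha).le
          _ = (n + 1 : ℕ) := by push_cast; rfl
      · calc G.edist x y ≤ G.edist x z + G.edist z y := G.edist_triangle
          _ ≤ 1 + n := add_le_add (edist_eq_one_iff_adj.2 ha).le (ih z y (by omega))
          _ = (n + 1 : ℕ) := by push_cast; rw [add_comm]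
  · by_cases hr : G.Reachable x y
    · obtain ⟨p, hp⟩ := hr.exists_walk_length_eq_edist
      rw [← hp, Nat.cast_le]
      clear hp hr
      have key : ∀ {y z : V} (q : G.Walk y z), D x z ≤ D x y + q.length := by
        intro y z q
        induction q with
        | nil => simp
        | cons h q ih =>
          have := hlip x _ _ h
          rw [Walk.length_cons]
          omega
      simpa [hself] using key p
    · simp [edist_eq_top_of_not_reachable hr]

/-- Maps that send each edge to an edge or to a single vertex do not increase distances. -/
lemma edist_le_of_weakHom {V W : Type*} {G : SimpleGraph V} {H : SimpleGraph W} (f : V → W)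
    (hf : ∀ x y, G.Adj x y → H.Adj (f x) (f y) ∨ f x = f y) (x y : V) :
    H.edist (f x) (f y) ≤ G.edist x y := by
  by_cases hr : G.Reachable x y
  · obtain ⟨p, hp⟩ := hr.exists_walk_length_eq_edist
    rw [← hp]
    clear hp hr
    induction p with
    | nil => simp
    | @cons u v w h q ih =>
      calc H.edist (f u) (f w) ≤ H.edist (f u) (f v) + H.edist (f v) (f w) := H.edist_triangle
        _ ≤ 1 + q.length := add_le_add (edist_le_one_iff_adj_or_eq.2 (hf _ _ h)) ih
        _ = _ := by rw [Walk.length_cons]; push_cast; rw [add_comm]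
  · simp [edist_eq_top_of_not_reachable hr]

lemma edist_iso {V W : Type*} {G : SimpleGraph V} {H : SimpleGraph W} (e : G ≃g H) (x y : V) :
    H.edist (e x) (e y) = G.edist x y := by
  refine le_antisymm (edist_le_of_weakHom e (fun _ _ h => Or.inl (e.map_adj_iff.2 h)) x y) ?_
  simpa using edist_le_of_weakHom e.symm (fun _ _ h => Or.inl (e.symm.map_adj_iff.2 h)) (e x) (e y)

/-- In a tree, the vertex at a given distance on the geodesic between two vertices is unique. -/
lemma IsTree.eq_of_dist_add_dist {W : Type*} {U : SimpleGraph W} (hU : U.IsTree) {x y u v : W}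
    (huv : U.dist x u = U.dist x v) (hu : U.dist x u + U.dist u y = U.dist x y)
    (hv : U.dist x v + U.dist v y = U.dist x y) : u = v := by
  have key : ∀ w, U.dist x w + U.dist w y = U.dist x y →
      ∃ p : U.Walk x y, p.IsPath ∧ p.getVert (U.dist x w) = w := by
    intro w hw
    obtain ⟨p, hp⟩ := hU.connected.exists_walk_length_eq_dist x w
    obtain ⟨q, hq⟩ := hU.connected.exists_walk_length_eq_dist w y
    refine ⟨p.append q, Walk.isPath_of_length_eq_dist _ (by rw [Walk.length_append]; omega), ?_⟩
    rw [Walk.getVert_append, ← hp]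
    simp
  obtain ⟨p, hp, hpu⟩ := key u hu
  obtain ⟨q, hq, hqv⟩ := key v hv
  obtain rfl := (hU.existsUnique_path x y).unique hp hq
  rw [← hpu, ← hqv, huv]

lemma IsAcyclic.not_triangle {W : Type*} {U : SimpleGraph W} (hU : U.IsAcyclic) {a b c : W}
    (hab : U.Adj a b) (hbc : U.Adj b c) (hca : U.Adj c a) : False := by
  have := (hU.subsingleton_path a b).elim (Path.singleton hab)
    ⟨.cons hca.symm (.cons hbc.symm .nil), by
      simp [hab.ne, hbc.ne', hca.ne']⟩
  have := congrArg (fun p : U.Path a b => p.1.length) this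
  simp [Path.singleton] at this

section SubdividedStar

variable {b l b' l' : ℕ}

/-- The distance of a vertex of the subdivided star from the centre. -/
def starHeight : Option (Fin b × Fin l) → ℕ
  | none => 0
  | some (_, j) => j + 1

/-- The distance function of the subdivided star. -/
def starDist : Option (Fin b × Fin l) → Option (Fin b × Fin l) → ℕ
  | some (a, j), some (a', j') =>
    if a = a' then (j - j' : ℕ) + (j' - j) else (j + 1) + (j' + 1)
  | none, y => starHeight y
  | x, none => starHeight x

/-- The neighbour of a vertex on the way to the centre; the centre is its own parent. -/
def starParent : Option (Fin b × Fin l) → Option (Fin b × Fin l)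
  | none => none
  | some (a, j) => if (j : ℕ) = 0 then none else some (a, ⟨j - 1, by omega⟩)

lemma subdividedStar_adj_iff {x y : Option (Fin b × Fin l)} :
    (subdividedStar b l).Adj x y ↔
      (x ≠ none ∧ starParent x = y) ∨ (y ≠ none ∧ starParent y = x) := by
  rcases x with _ | ⟨a, j⟩ <;> rcases y with _ | ⟨a', j'⟩ <;>
    (simp [subdividedStar, starParent]; try grind)

lemma starDist_comm (x y : Option (Fin b × Fin l)) : starDist x y = starDist y x := by
  rcases x with _ | ⟨a, j⟩ <;> rcases y with _ | ⟨a', j'⟩ <;> simp only [starDist, starHeight]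
  grind

lemma starDist_none_left (x : Option (Fin b × Fin l)) : starDist none x = starHeight x := by
  cases x <;> rfl

lemma starDist_none_right (x : Option (Fin b × Fin l)) : starDist x none = starHeight x := by
  cases x <;> rfl

lemma starDist_self (x : Option (Fin b × Fin l)) : starDist x x = 0 := by
  rcases x with _ | ⟨a, j⟩ <;> simp [starDist, starHeight]

lemma eq_of_starDist_eq_zero {x y : Option (Fin b × Fin l)} (h : starDist x y = 0) : x = y := by
  rcases x with _ | ⟨a, j⟩ <;> rcases y with _ | ⟨a', j'⟩ <;>
    simp only [starDist, starHeight] at h <;> grind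

lemma starHeight_parent {x : Option (Fin b × Fin l)} (hx : x ≠ none) :
    starHeight (starParent x) + 1 = starHeight x := by
  rcases x with _ | ⟨a, j⟩ <;> simp only [starParent, starHeight] <;> grind [starHeight]

lemma starDist_parent_lipschitz (x y : Option (Fin b × Fin l)) :
    starDist x y ≤ starDist x (starParent y) + 1 ∧ starDist x (starParent y) ≤ starDist x y + 1 := by
  rcases x with _ | ⟨a, j⟩ <;> rcases y with _ | ⟨a', j'⟩ <;>
    simp only [starParent] <;> grind [starDist, starHeight]

/-- Moving the higher of two distinct vertices to its parent brings them one step closer. -/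
lemma starDist_parent_step {x y : Option (Fin b × Fin l)} (hxy : x ≠ y)
    (h : starHeight x ≤ starHeight y) :
    y ≠ none ∧ starDist x (starParent y) + 1 = starDist x y := by
  rcases x with _ | ⟨a, j⟩ <;> rcases y with _ | ⟨a', j'⟩ <;>
    simp only [starParent] <;> grind [starDist, starHeight]

/-- Three vertices of a subdivided star either lie on a common path, or lie on three different
branches, so that all pairwise geodesics pass through the centre. -/
lemma starDist_trichotomy (x y z : Option (Fin b × Fin l)) :
    starDist x y = starDist x z + starDist z y ∨ starDist x z = starDist x y + starDist y z ∨
    starDist y z = starDist y x + starDist x z ∨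
    (starDist x y = starHeight x + starHeight y ∧ starDist x z = starHeight x + starHeight z ∧
      starDist y z = starHeight y + starHeight z) := by
  rcases x with _ | ⟨a, j⟩ <;> rcases y with _ | ⟨a', j'⟩ <;> rcases z with _ | ⟨a'', j''⟩ <;>
    simp only [starDist, starHeight] <;> grind

end SubdividedStar

end SimpleGraph

/-! ### Double stars and the triangle of stars -/

namespace SimpleGraph

/-- Two subdivided stars whose centres are joined by an edge. -/
def doubleStar (b l b' l' : ℕ) :
    SimpleGraph (Option (Fin b × Fin l) ⊕ Option (Fin b' × Fin l')) :=
  (subdividedStar b l ⊕g subdividedStar b' l') ⊔ edge (Sum.inl none) (Sum.inr none)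

section DoubleStar

variable {b l b' l' : ℕ}

/-- The neighbour of a vertex on the way to the centre of the left star, taken as the root. -/
def doubleStarParent : Option (Fin b × Fin l) ⊕ Option (Fin b' × Fin l') →
    Option (Fin b × Fin l) ⊕ Option (Fin b' × Fin l')
  | Sum.inl x => Sum.inl (starParent x)
  | Sum.inr none => Sum.inl none
  | Sum.inr (some y) => Sum.inr (starParent (some y))

/-- The distance function of the double star. -/
def doubleStarDist : Option (Fin b × Fin l) ⊕ Option (Fin b' × Fin l') →
    Option (Fin b × Fin l) ⊕ Option (Fin b' × Fin l') → ℕ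
  | Sum.inl x, Sum.inl y => starDist x y
  | Sum.inr x, Sum.inr y => starDist x y
  | Sum.inl x, Sum.inr y => starHeight x + 1 + starHeight y
  | Sum.inr y, Sum.inl x => starHeight x + 1 + starHeight y

lemma doubleStar_adj_inl {x y : Option (Fin b × Fin l)} :
    (doubleStar b l b' l').Adj (Sum.inl x) (Sum.inl y) ↔ (subdividedStar b l).Adj x y := by
  simp [doubleStar, edge_adj]

lemma doubleStar_adj_inr {x y : Option (Fin b' × Fin l')} :
    (doubleStar b l b' l').Adj (Sum.inr x) (Sum.inr y) ↔ (subdividedStar b' l').Adj x y := by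
  simp [doubleStar, edge_adj]

lemma doubleStar_adj_inl_inr {x : Option (Fin b × Fin l)} {y : Option (Fin b' × Fin l')} :
    (doubleStar b l b' l').Adj (Sum.inl x) (Sum.inr y) ↔ x = none ∧ y = none := by
  simp [doubleStar, edge_adj]

lemma doubleStar_adj_iff {x y : Option (Fin b × Fin l) ⊕ Option (Fin b' × Fin l')} :
    (doubleStar b l b' l').Adj x y ↔
      (x ≠ Sum.inl none ∧ doubleStarParent x = y) ∨
        (y ≠ Sum.inl none ∧ doubleStarParent y = x) := by
  rcases x with x | (_ | x) <;> rcases y with y | (_ | y) <;>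
    simp [doubleStar_adj_inl, doubleStar_adj_inr, doubleStar_adj_inl_inr, adj_comm _ (Sum.inr _)
      (Sum.inl _), subdividedStar_adj_iff, doubleStarParent, starParent] <;> grind

lemma doubleStarDist_comm (x y : Option (Fin b × Fin l) ⊕ Option (Fin b' × Fin l')) :
    doubleStarDist x y = doubleStarDist y x := by
  rcases x with x | x <;> rcases y with y | y <;> simp [doubleStarDist, starDist_comm]

lemma doubleStarDist_parent_lipschitz
    (x y : Option (Fin b × Fin l) ⊕ Option (Fin b' × Fin l')) :
    doubleStarDist x y ≤ doubleStarDist x (doubleStarParent y) + 1 ∧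
      doubleStarDist x (doubleStarParent y) ≤ doubleStarDist x y + 1 := by
  rcases x with x | x <;> rcases y with y | (_ | y)
  · exact starDist_parent_lipschitz x y
  · simp [doubleStarDist, doubleStarParent, starDist_none_right, starHeight]; omega
  · have := starDist_parent_lipschitz none (some y)
    simp only [starDist_none_left] at this
    simp only [doubleStarDist, doubleStarParent]; omega
  · have := starDist_parent_lipschitz none y
    simp only [starDist_none_left] at this
    simp only [doubleStarDist, doubleStarParent]; omega
  · simp only [doubleStarDist, doubleStarParent, starDist_none_right, starHeight]; omega
  · exact starDist_parent_lipschitz x (some y)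

lemma doubleStar_edist (x y : Option (Fin b × Fin l) ⊕ Option (Fin b' × Fin l')) :
    (doubleStar b l b' l').edist x y = doubleStarDist x y := by
  have hadj : ∀ z : Option (Fin b × Fin l) ⊕ Option (Fin b' × Fin l'), z ≠ Sum.inl none →
      (doubleStar b l b' l').Adj (doubleStarParent z) z :=
    fun z hz => doubleStar_adj_iff.2 (Or.inr ⟨hz, rfl⟩)
  refine edist_eq_of_lipschitz_of_step ?_ ?_ ?_ x y
  · rintro (x | x) <;> simp [doubleStarDist, starDist_self]
  · intro x y z h
    rcases doubleStar_adj_iff.1 h with ⟨-, rfl⟩ | ⟨-, rfl⟩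
    · exact (doubleStarDist_parent_lipschitz x y).2
    · exact (doubleStarDist_parent_lipschitz x z).1
  · -- By symmetry it is enough to treat pairs in which the second vertex is the one to move.
    have main : ∀ x y : Option (Fin b × Fin l) ⊕ Option (Fin b' × Fin l'), x ≠ y →
        (y ≠ Sum.inl none ∧ doubleStarDist x (doubleStarParent y) + 1 = doubleStarDist x y) ∨
        (x ≠ Sum.inl none ∧ doubleStarDist y (doubleStarParent x) + 1 = doubleStarDist y x) := by
      have same : ∀ {c m : ℕ} (x y : Option (Fin c × Fin m)), x ≠ y →
          (y ≠ none ∧ starDist x (starParent y) + 1 = starDist x y) ∨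
          (x ≠ none ∧ starDist y (starParent x) + 1 = starDist y x) := by
        intro c m x y hxy
        rcases le_total (starHeight x) (starHeight y) with h | h
        · exact Or.inl (starDist_parent_step hxy h)
        · exact Or.inr (starDist_parent_step hxy.symm h)
      have across : ∀ (x : Option (Fin b × Fin l)) (y : Option (Fin b' × Fin l')),
          doubleStarDist (Sum.inl x) (doubleStarParent (Sum.inr y)) + 1 =
            doubleStarDist (Sum.inl x) (Sum.inr y) := by
        rintro x (_ | y)
        · simp [doubleStarDist, doubleStarParent, starDist_none_right, starHeight]
        · have := starHeight_parent (Option.some_ne_none y)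
          simp only [doubleStarDist, doubleStarParent]; omega
      rintro (x | x) (y | y) hxy
      · simpa [doubleStarDist, doubleStarParent] using same x y (by simpa using hxy)
      · exact Or.inl ⟨by simp, across x y⟩
      · exact Or.inr ⟨by simp, across y x⟩
      · have h := same x y (by simpa using hxy)
        rcases h with ⟨hy, h⟩ | ⟨hx, h⟩
        · obtain ⟨y, rfl⟩ := Option.ne_none_iff_exists'.1 hy
          exact Or.inl ⟨by simp, h⟩
        · obtain ⟨x, rfl⟩ := Option.ne_none_iff_exists'.1 hx
          exact Or.inr ⟨by simp, h⟩
    intro x y hxy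
    rcases main x y hxy with ⟨hy, h⟩ | ⟨hx, h⟩
    · exact ⟨_, Or.inl ⟨hadj y hy, h⟩⟩
    · refine ⟨_, Or.inr ⟨(hadj x hx).symm, ?_⟩⟩
      rw [doubleStarDist_comm _ y, h, doubleStarDist_comm]

lemma doubleStar_isTree (b l b' l' : ℕ) : (doubleStar b l b' l').IsTree := by
  classical
  have hconn : (doubleStar b l b' l').Connected :=
    { preconnected := fun x y => reachable_of_edist_ne_top (by simp [doubleStar_edist]) }
  rw [isTree_iff_connected_and_card]
  refine ⟨hconn, le_antisymm ?_ hconn.card_vert_le_card_edgeSet_add_one⟩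
  -- Every edge joins a vertex other than the root to its parent.
  let e : {v : Option (Fin b × Fin l) ⊕ Option (Fin b' × Fin l') // v ≠ Sum.inl none} →
      (doubleStar b l b' l').edgeSet :=
    fun v => ⟨s(v.1, doubleStarParent v.1), doubleStar_adj_iff.2 (Or.inl ⟨v.2, rfl⟩)⟩
  have he : Function.Surjective e := by
    rintro ⟨s, hs⟩
    induction s using Sym2.ind with
    | _ x y =>
      have hxy : (doubleStar b l b' l').Adj x y := hs
      rcases doubleStar_adj_iff.1 hxy with ⟨hx, rfl⟩ | ⟨hy, rfl⟩
      · exact ⟨⟨x, hx⟩, rfl⟩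
      · exact ⟨⟨y, hy⟩, Subtype.ext Sym2.eq_swap⟩
  have := Nat.card_le_card_of_surjective e he
  rw [Nat.card_eq_fintype_card (α := {v // v ≠ _}), Fintype.card_subtype_compl,
    Fintype.card_subtype_eq] at this
  have hpos : 0 < Fintype.card (Option (Fin b × Fin l) ⊕ Option (Fin b' × Fin l')) :=
    Fintype.card_pos_iff.2 ⟨Sum.inl none⟩
  rw [Nat.card_eq_fintype_card (α := _ ⊕ _)]
  omega

end DoubleStar

/-- An injective map that preserves distances exhibits an isometric subgraph. -/
lemma exists_isIsometric_of_edist {V W : Type*} {G : SimpleGraph V} {U : SimpleGraph W} (f : V → W)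
    (hf : Function.Injective f) (hd : ∀ x y, U.edist (f x) (f y) = G.edist x y) :
    ∃ H : U.Subgraph, H.IsIsometric ∧ Nonempty (G ≃g H.coe) := by
  have hadj : ∀ x y, G.Adj x y → U.Adj (f x) (f y) := fun x y h => by
    rw [← edist_eq_one_iff_adj, hd, edist_eq_one_iff_adj.2 h]
  let c : Copy G U := ⟨⟨f, fun h => hadj _ _ h⟩, hf⟩
  refine ⟨c.toSubgraph, fun u v => ?_, ⟨c.isoToSubgraph⟩⟩
  obtain ⟨x, rfl⟩ := c.isoToSubgraph.surjective u
  obtain ⟨y, rfl⟩ := c.isoToSubgraph.surjective v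
  rw [edist_iso]
  exact (hd x y).symm

/-- A member of the family embeds into an isometric-universal graph with distances preserved. -/
lemma IsIsometricUniversal.exists_edist {ι : Type*} {V : ι → Type*} {W : Type*}
    {F : (i : ι) → SimpleGraph (V i)} {U : SimpleGraph W} (h : IsIsometricUniversal F U) (i : ι) :
    ∃ f : V i → W, ∀ x y, U.edist (f x) (f y) = (F i).edist x y := by
  obtain ⟨H, hH, ⟨e⟩⟩ := h i
  exact ⟨fun x => (e x : W), fun x y => by rw [← hH, edist_iso]⟩

end SimpleGraph

namespace ThreeTrees

open SimpleGraph

lemma tree_eq_doubleStar (t : ℕ) (k : Fin 3) :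
    tree t k = doubleStar (t ^ ((k : ℕ) + 1)) (t ^ (3 - ((k : ℕ) + 1)))
      (t ^ (((k + 1 : Fin 3) : ℕ) + 1)) (t ^ (3 - (((k + 1 : Fin 3) : ℕ) + 1))) :=
  rfl

lemma card_starVertex (t : ℕ) (k : Fin 3) : Nat.card (StarVertex t k) = t ^ 3 + 1 := by
  simp only [Nat.card_eq_fintype_card, Fintype.card_option, Fintype.card_prod, Fintype.card_fin,
    ← pow_add]
  congr 2
  omega

/-- The inclusion of the tree `T_{k+1}` in the three stars with a triangle on their centres. -/
def treeInclusion (t : ℕ) (k : Fin 3) :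
    StarVertex t k ⊕ StarVertex t (k + 1) → Σ k : Fin 3, StarVertex t k :=
  Sum.elim (Sigma.mk k) (Sigma.mk (k + 1))

/-- The map onto the tree `T_{k+1}` that collapses the star outside it to the centre of the star
of type `k + 1`. -/
def treeRetraction (t : ℕ) (k : Fin 3) (x : Σ k : Fin 3, StarVertex t k) :
    StarVertex t k ⊕ StarVertex t (k + 1) :=
  if h : x.1 = k then Sum.inl (h ▸ x.2)
  else if h : x.1 = k + 1 then Sum.inr (h ▸ x.2)
  else Sum.inl none

lemma ne_add_one (k : Fin 3) : k + 1 ≠ k := by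
  revert k; decide

lemma treeRetraction_left (t : ℕ) (k : Fin 3) (x : StarVertex t k) :
    treeRetraction t k ⟨k, x⟩ = Sum.inl x := by
  simp [treeRetraction]

lemma treeRetraction_right (t : ℕ) (k : Fin 3) (x : StarVertex t (k + 1)) :
    treeRetraction t k ⟨k + 1, x⟩ = Sum.inr x := by
  simp [treeRetraction]

lemma treeRetraction_of_ne (t : ℕ) {k k' : Fin 3} (h : k' ≠ k) (h' : k' ≠ k + 1)
    (x : StarVertex t k') : treeRetraction t k ⟨k', x⟩ = Sum.inl none := by
  simp [treeRetraction, h, h']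

lemma treeRetraction_inclusion (t : ℕ) (k : Fin 3) (x : StarVertex t k ⊕ StarVertex t (k + 1)) :
    treeRetraction t k (treeInclusion t k x) = x := by
  rcases x with x | x
  · exact treeRetraction_left t k x
  · exact treeRetraction_right t k x

lemma treeRetraction_weakHom (t : ℕ) (k : Fin 3) (x y : Σ k : Fin 3, StarVertex t k)
    (h : (triangleOfStars t).Adj x y) :
    (tree t k).Adj (treeRetraction t k x) (treeRetraction t k y) ∨
      treeRetraction t k x = treeRetraction t k y := by
  rcases h with ⟨k', a, b, rfl, rfl, h⟩ | ⟨h, hx, hy⟩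
  · by_cases hk : k' = k
    · subst hk
      rw [treeRetraction_left, treeRetraction_left]
      exact Or.inl (doubleStar_adj_inl.2 h)
    by_cases hk' : k' = k + 1
    · subst hk'
      rw [treeRetraction_right, treeRetraction_right]
      exact Or.inl (doubleStar_adj_inr.2 h)
    · rw [treeRetraction_of_ne t hk hk', treeRetraction_of_ne t hk hk']
      exact Or.inr rfl
  · have hcentre : ∀ k' : Fin 3, treeRetraction t k ⟨k', none⟩ = Sum.inl none ∨
        treeRetraction t k ⟨k', none⟩ = Sum.inr none := by
      intro k'
      by_cases hk : k' = k
      · subst hk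
        exact Or.inl (treeRetraction_left t k' none)
      by_cases hk' : k' = k + 1
      · subst hk'
        exact Or.inr (treeRetraction_right t k none)
      · exact Or.inl (treeRetraction_of_ne t hk hk' none)
    have hadj : (tree t k).Adj (Sum.inl none) (Sum.inr none) :=
      doubleStar_adj_inl_inr.2 ⟨rfl, rfl⟩
    obtain ⟨i, x⟩ := x
    obtain ⟨j, y⟩ := y
    obtain rfl : x = none := hx
    obtain rfl : y = none := hy
    rcases hcentre i with hi | hi <;> rcases hcentre j with hj | hj <;> rw [hi, hj]
    · exact Or.inr rfl
    · exact Or.inl hadj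
    · exact Or.inl hadj.symm
    · exact Or.inr rfl

lemma treeInclusion_adj (t : ℕ) (k : Fin 3) (x y : StarVertex t k ⊕ StarVertex t (k + 1))
    (h : (tree t k).Adj x y) :
    (triangleOfStars t).Adj (treeInclusion t k x) (treeInclusion t k y) := by
  rcases x with x | x <;> rcases y with y | y
  · exact Or.inl ⟨k, x, y, rfl, rfl, doubleStar_adj_inl.1 h⟩
  · obtain ⟨rfl, rfl⟩ := doubleStar_adj_inl_inr.1 h
    exact Or.inr ⟨(ne_add_one k).symm, rfl, rfl⟩
  · obtain ⟨rfl, rfl⟩ := doubleStar_adj_inl_inr.1 h.symm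
    exact Or.inr ⟨ne_add_one k, rfl, rfl⟩
  · exact Or.inl ⟨k + 1, x, y, rfl, rfl, doubleStar_adj_inr.1 h⟩

lemma isIsometricUniversal_triangleOfStars (t : ℕ) :
    IsIsometricUniversal (tree t) (triangleOfStars t) := by
  refine fun k => exists_isIsometric_of_edist (treeInclusion t k)
    (Function.LeftInverse.injective (treeRetraction_inclusion t k)) fun x y => ?_
  refine le_antisymm
    (edist_le_of_weakHom _ (fun x y h => Or.inl (treeInclusion_adj t k x y h)) x y) ?_
  simpa only [treeRetraction_inclusion] using edist_le_of_weakHom _ (treeRetraction_weakHom t k)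
    (treeInclusion t k x) (treeInclusion t k y)

end ThreeTrees

/-! ### Pathwidth and interval graphs -/

namespace SimpleGraph

/-- The intersection graph of the closed intervals `[l v, r v]`. -/
def intervalGraph {V : Type*} (l r : V → ℝ) : SimpleGraph V where
  Adj u v := u ≠ v ∧ (Set.Icc (l u) (r u) ∩ Set.Icc (l v) (r v)).Nonempty
  symm := ⟨fun _ _ h => ⟨h.1.symm, by rw [Set.inter_comm]; exact h.2⟩⟩
  loopless := ⟨fun _ h => h.1 rfl⟩

/-- The graph contains the spider with three legs of length two: a vertex `o` with three different
neighbours `a i`, each of which has a further neighbour `w i`. -/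
def HasSpider {V : Type*} (G : SimpleGraph V) : Prop :=
  ∃ (o : V) (a w : Fin 3 → V), Function.Injective a ∧
    ∀ i, G.Adj o (a i) ∧ G.Adj (a i) (w i) ∧ w i ≠ o

lemma HasSpider.of_isContained {V W : Type*} {G : SimpleGraph V} {H : SimpleGraph W}
    (h : G.HasSpider) (hGH : G.IsContained H) : H.HasSpider := by
  obtain ⟨f⟩ := hGH
  obtain ⟨o, a, w, ha, hs⟩ := h
  exact ⟨f o, f ∘ a, f ∘ w, f.injective.comp ha, fun i => ⟨f.toHom.map_adj (hs i).1,
    f.toHom.map_adj (hs i).2.1, f.injective.ne (hs i).2.2⟩⟩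

lemma Icc_inter_Icc_nonempty_iff {a b c d : ℝ} (hab : a ≤ b) (hcd : c ≤ d) :
    (Set.Icc a b ∩ Set.Icc c d).Nonempty ↔ a ≤ d ∧ c ≤ b := by
  rw [Set.Icc_inter_Icc, Set.nonempty_Icc, sup_le_iff, le_inf_iff, le_inf_iff]
  tauto

/-- An interval graph containing a spider contains a triangle. Without triangles the intervals of
the three neighbours of the body would be disjoint, so the middle one would lie inside the interval
of the body, and whatever meets it would also meet the body. -/
lemma IsIntervalGraph.not_cliqueFree_three {V : Type*} {H : SimpleGraph V}
    (hH : H.IsIntervalGraph) (hs : H.HasSpider) : ¬ H.CliqueFree 3 := by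
  classical
  intro hfree
  obtain ⟨l, r, hlr, hadj⟩ := hH
  obtain ⟨o, a, w, ha, hs⟩ := hs
  have hadj' : ∀ u v, H.Adj u v ↔ u ≠ v ∧ l u ≤ r v ∧ l v ≤ r u := fun u v => by
    rw [hadj, Icc_inter_Icc_nonempty_iff (hlr u) (hlr v)]
  have htri : ∀ x y z, H.Adj x y → H.Adj x z → ¬ H.Adj y z := fun x y z h₁ h₂ h₃ =>
    hfree {x, y, z} (is3Clique_triple_iff.2 ⟨h₁, h₂, h₃⟩)
  have hsep : ∀ i j, i ≠ j → r (a i) < l (a j) ∨ r (a j) < l (a i) := by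
    intro i j hij
    have := htri o (a i) (a j) (hs i).1 (hs j).1
    rw [hadj'] at this
    by_contra! h
    exact this ⟨ha.ne hij, h.2, h.1⟩
  have hmid : ∀ i j k, r (a i) < l (a j) → r (a j) < l (a k) → False := by
    intro i j k hij hjk
    have h₁ := ((hadj' _ _).1 (hs i).1).2
    have h₂ := ((hadj' _ _).1 (hs k).1).2
    have h₃ := ((hadj' _ _).1 (hs j).2.1).2
    exact htri (a j) o (w j) (hs j).1.symm (hs j).2.1
      ((hadj' _ _).2 ⟨(hs j).2.2.symm, by linarith, by linarith⟩)
  rcases hsep 0 1 (by decide) with h₁ | h₁ <;> rcases hsep 1 2 (by decide) with h₂ | h₂ <;>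
    rcases hsep 0 2 (by decide) with h₃ | h₃
  · exact hmid _ _ _ h₁ h₂
  · exact hmid _ _ _ h₁ h₂
  · exact hmid _ _ _ h₃ h₂
  · exact hmid _ _ _ h₃ h₁
  · exact hmid _ _ _ h₁ h₃
  · exact hmid _ _ _ h₂ h₃
  · exact hmid _ _ _ h₂ h₁
  · exact hmid _ _ _ h₂ h₁

lemma IsIntervalGraph.three_le_cliqueNum {V : Type*} [Finite V] {H : SimpleGraph V}
    (hH : H.IsIntervalGraph) (hs : H.HasSpider) : 3 ≤ H.cliqueNum := by
  have := hH.not_cliqueFree_three hs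
  simp only [CliqueFree, not_forall, not_not] at this
  obtain ⟨s, hs⟩ := this
  exact hs.card_eq ▸ hs.isClique.card_le_cliqueNum

/-- A graph containing a spider has pathwidth two if its vertices can be represented by intervals
and coloured with three colours, so that adjacent vertices have meeting intervals and different
vertices with meeting intervals have different colours. -/
lemma pathwidth_eq_two {V : Type*} [Finite V] {G : SimpleGraph V} (hs : G.HasSpider)
    (l r : V → ℝ) (hlr : ∀ v, l v ≤ r v) (hG : ∀ u v, G.Adj u v → l u ≤ r v ∧ l v ≤ r u)
    (χ : V → Fin 3) (hχ : ∀ u v, u ≠ v → l u ≤ r v → l v ≤ r u → χ u ≠ χ v) :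
    G.pathwidth = 2 := by
  have hmem : 2 ∈ {p : ℕ | ∃ (m : ℕ) (H : SimpleGraph (Fin m)),
      H.IsIntervalGraph ∧ G.IsContained H ∧ H.cliqueNum = p + 1} := by
    let e := Finite.equivFin V
    let H := intervalGraph (l ∘ e.symm) (r ∘ e.symm)
    have hH : H.IsIntervalGraph := ⟨_, _, fun v => hlr _, fun u v => Iff.rfl⟩
    have hcont : G.IsContained H := by
      refine ⟨⟨⟨e, fun {u v} h => ⟨e.injective.ne h.ne, ?_⟩⟩, e.injective⟩⟩
      exact (Icc_inter_Icc_nonempty_iff (hlr _) (hlr _)).2 (by simpa using hG u v h)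
    refine ⟨_, H, hH, hcont,
      le_antisymm ?_ (hH.three_le_cliqueNum (hs.of_isContained hcont))⟩
    have hcol : H.Colorable 3 := by
      refine ⟨Coloring.mk (χ ∘ e.symm) fun {u v} h => ?_⟩
      obtain ⟨huv, h⟩ := h
      have h := (Icc_inter_Icc_nonempty_iff (hlr (e.symm u)) (hlr (e.symm v))).1 h
      exact hχ _ _ (e.symm.injective.ne huv) h.1 h.2
    obtain ⟨s, hs⟩ := H.exists_isNClique_cliqueNum
    have := hs.isClique.card_le_of_colorable hcol
    rwa [hs.card_eq] at this
  refine le_antisymm (Nat.sInf_le hmem) (le_csInf ⟨2, hmem⟩ ?_)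
  rintro p ⟨m, H, hH, hcont, hp⟩
  have := hH.three_le_cliqueNum (hs.of_isContained hcont)
  omega

section DoubleStar

variable {b l b' l' : ℕ}

/-- Left endpoints of an interval representation of a supergraph of the double star: the branches
of each star are laid out one after the other as a chain of unit intervals, below the interval of
the centre; the two stars occupy the two half-lines, and only the centres meet, at `0`. -/
def doubleStarLeft : Option (Fin b × Fin l) ⊕ Option (Fin b' × Fin l') → ℤ
  | Sum.inl none => 0
  | Sum.inl (some p) => (finProdFinEquiv p : ℕ) + 1
  | Sum.inr none => -((b' * l' : ℕ) + 1)
  | Sum.inr (some p) => -((finProdFinEquiv p : ℕ) + 2)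

/-- Right endpoints of the intervals with left endpoints `doubleStarLeft`. -/
def doubleStarRight : Option (Fin b × Fin l) ⊕ Option (Fin b' × Fin l') → ℤ
  | Sum.inl none => (b * l : ℕ) + 1
  | Sum.inl (some p) => (finProdFinEquiv p : ℕ) + 2
  | Sum.inr none => 0
  | Sum.inr (some p) => -((finProdFinEquiv p : ℕ) + 1)

/-- A proper colouring of the interval graph given by `doubleStarLeft` and `doubleStarRight`. -/
def doubleStarColour : Option (Fin b × Fin l) ⊕ Option (Fin b' × Fin l') → ℕ
  | Sum.inl none => 2
  | Sum.inl (some p) => (finProdFinEquiv p : ℕ) % 2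
  | Sum.inr none => 0
  | Sum.inr (some p) => (finProdFinEquiv p : ℕ) % 2 + 1

lemma doubleStarColour_lt (x : Option (Fin b × Fin l) ⊕ Option (Fin b' × Fin l')) :
    doubleStarColour x < 3 := by
  rcases x with (_ | x) | (_ | x) <;> simp only [doubleStarColour] <;> omega

lemma doubleStarLeft_le_right (x : Option (Fin b × Fin l) ⊕ Option (Fin b' × Fin l')) :
    doubleStarLeft x ≤ doubleStarRight x := by
  rcases x with (_ | x) | (_ | x) <;> simp only [doubleStarLeft, doubleStarRight] <;> omega

lemma doubleStarInterval_parent (x : Option (Fin b × Fin l) ⊕ Option (Fin b' × Fin l')) :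
    doubleStarLeft x ≤ doubleStarRight (doubleStarParent x) ∧
      doubleStarLeft (doubleStarParent x) ≤ doubleStarRight x := by
  have hlt : ∀ {c m : ℕ} (p : Fin c × Fin m), (finProdFinEquiv p : ℕ) < c * m := fun p =>
    (finProdFinEquiv p).2
  rcases x with (_ | ⟨a, j⟩) | (_ | ⟨a, j⟩)
  · simp only [doubleStarParent, starParent, doubleStarLeft, doubleStarRight]; omega
  · have := hlt (a, j)
    simp only [doubleStarParent, starParent]
    split_ifs with h <;> simp only [doubleStarLeft, doubleStarRight]
    · omega
    · simp only [finProdFinEquiv_apply_val]; omega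
  · simp only [doubleStarParent, doubleStarLeft, doubleStarRight]; omega
  · have := hlt (a, j)
    simp only [doubleStarParent, starParent]
    split_ifs with h <;> simp only [doubleStarLeft, doubleStarRight]
    · omega
    · simp only [finProdFinEquiv_apply_val]; omega

lemma doubleStarColour_ne {x y : Option (Fin b × Fin l) ⊕ Option (Fin b' × Fin l')}
    (hxy : x ≠ y) (h : doubleStarLeft x ≤ doubleStarRight y)
    (h' : doubleStarLeft y ≤ doubleStarRight x) : doubleStarColour x ≠ doubleStarColour y := by
  have hne : ∀ {c m : ℕ} {p q : Fin c × Fin m}, p ≠ q →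
      (finProdFinEquiv p : ℕ) ≠ finProdFinEquiv q := fun h =>
    Fin.val_injective.ne (finProdFinEquiv.injective.ne h)
  rcases x with (_ | x) | (_ | x) <;> rcases y with (_ | y) | (_ | y) <;>
    simp only [doubleStarLeft, doubleStarRight] at h h' <;> simp only [doubleStarColour]
  all_goals first
    | exact absurd rfl hxy
    | (have := hne (p := x) (q := y) (by simpa using hxy)
       omega)
    | omega

lemma doubleStar_pathwidth (hs : (doubleStar b l b' l').HasSpider) :
    (doubleStar b l b' l').pathwidth = 2 := by
  refine pathwidth_eq_two hs (fun v => doubleStarLeft v) (fun v => doubleStarRight v)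
    (fun v => Int.cast_le.2 (doubleStarLeft_le_right v)) (fun u v h => ?_)
    (fun v => ⟨doubleStarColour v, doubleStarColour_lt v⟩) (fun u v huv h h' => ?_)
  · simp only [Int.cast_le]
    rcases doubleStar_adj_iff.1 h with ⟨-, rfl⟩ | ⟨-, rfl⟩
    · exact doubleStarInterval_parent u
    · exact (doubleStarInterval_parent v).symm
  · rw [Int.cast_le] at h h'
    simpa [Fin.ext_iff] using doubleStarColour_ne huv h h'

lemma subdividedStar_hasSpider (hb : 3 ≤ b) (hl : 2 ≤ l) : (subdividedStar b l).HasSpider := by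
  refine ⟨none, fun i => some (⟨i, by omega⟩, ⟨0, by omega⟩),
    fun i => some (⟨i, by omega⟩, ⟨1, by omega⟩), ?_, fun i => ⟨?_, ?_, ?_⟩⟩
  · intro i j h
    simpa [Fin.ext_iff] using h
  · exact subdividedStar_adj_iff.2 (Or.inr ⟨by simp, by simp [starParent]⟩)
  · exact subdividedStar_adj_iff.2 (Or.inr ⟨by simp, by simp [starParent]⟩)
  · simp

end DoubleStar

end SimpleGraph

namespace ThreeTrees

open SimpleGraph

/-- Among the types of the two stars of `T_{k+1}` at least one is not `3`, and in a star of type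
`1` or `2` the branches have length at least two. -/
lemma tree_pathwidth {t : ℕ} (ht : 3 ≤ t) (k : Fin 3) : (tree t k).pathwidth = 2 := by
  have hstar : ∀ i : Fin 3, i ≠ 2 → (star t i).HasSpider := by
    intro i hi
    refine subdividedStar_hasSpider (ht.trans (Nat.le_self_pow (by omega) t)) ?_
    exact (show 2 ≤ t by omega).trans (Nat.le_self_pow (by omega) t)
  refine doubleStar_pathwidth ?_
  by_cases hk : k = 2
  · refine (hstar (k + 1) (by subst hk; decide)).of_isContained ⟨⟨⟨Sum.inr, ?_⟩, Sum.inr_injective⟩⟩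
    exact fun h => doubleStar_adj_inr.2 h
  · refine (hstar k hk).of_isContained ⟨⟨⟨Sum.inl, ?_⟩, Sum.inl_injective⟩⟩
    exact fun h => doubleStar_adj_inl.2 h

end ThreeTrees

/-! ### Copies of stars in a tree -/

namespace SimpleGraph

section StarCopies

variable {W : Type*} {U : SimpleGraph W} {b l b' l' : ℕ}

/-- The map `f` places an isometric copy of the subdivided star in `U`. -/
def IsStarCopy (U : SimpleGraph W) (f : Option (Fin b × Fin l) → W) : Prop :=
  ∀ x y, U.dist (f x) (f y) = starDist x y

lemma IsStarCopy.injective {f : Option (Fin b × Fin l) → W} (hf : IsStarCopy U f) :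
    Function.Injective f := fun x y h =>
  eq_of_starDist_eq_zero (by rw [← hf, h, dist_self])

lemma IsStarCopy.ncard_range {f : Option (Fin b × Fin l) → W} (hf : IsStarCopy U f) :
    (Set.range f).ncard = b * l + 1 := by
  rw [← Set.image_univ, Set.ncard_image_of_injective _ hf.injective, Set.ncard_univ]
  simp

/-- If a star in a tree meets another star in vertices of three different branches, then the two
stars have the same centre. The centre of the first lies on all geodesics between the three common
vertices. Hence none of the three is between the other two, so in the second star, too, they are on
different branches, and its centre lies on the same geodesics at the same distances. -/
lemma IsStarCopy.centre_eq (hU : U.IsTree) {f : Option (Fin b × Fin l) → W}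
    {g : Option (Fin b' × Fin l') → W} (hf : IsStarCopy U f) (hg : IsStarCopy U g)
    {a : Fin 3 → Fin b} (ha : Function.Injective a)
    (h : ∀ i, ∃ j, f (some (a i, j)) ∈ Set.range g) : f none = g none := by
  choose j y hy using h
  have hd : ∀ i k, i ≠ k → starDist (y i) (y k) = (j i + 1) + (j k + 1) := by
    intro i k hik
    rw [← hg, hy, hy, hf]
    simp [starDist, ha.ne hik]
  have hd' : ∀ i, U.dist (g (y i)) (f none) = j i + 1 := fun i => by
    rw [hy, hf]
    rfl
  have hh : ∀ i, U.dist (g (y i)) (g none) = starHeight (y i) := fun i => by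
    rw [hg, starDist_none_right]
  have h₀₁ := hd 0 1 (by decide)
  have h₀₂ := hd 0 2 (by decide)
  have h₁₂ := hd 1 2 (by decide)
  have htri := starDist_trichotomy (y 0) (y 1) (y 2)
  rw [starDist_comm (y 2) (y 1), starDist_comm (y 1) (y 0), h₀₁, h₀₂, h₁₂] at htri
  refine hU.eq_of_dist_add_dist (x := g (y 0)) (y := g (y 1)) ?_ ?_ ?_
  · rw [hd', hh]; omega
  · rw [dist_comm (v := g (y 1)), hd', hd', hg, h₀₁]
  · rw [dist_comm (v := g (y 1)), hh, hh, hg, h₀₁]; omega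

/-- Two stars with different centres share, besides the centre, vertices of at most two branches of
the first. -/
lemma IsStarCopy.ncard_inter_le_of_ne (hU : U.IsTree) {f : Option (Fin b × Fin l) → W}
    {g : Option (Fin b' × Fin l') → W} (hf : IsStarCopy U f) (hg : IsStarCopy U g)
    (hne : f none ≠ g none) : (Set.range f ∩ Set.range g).ncard ≤ 2 * l + 1 := by
  classical
  let S : Finset (Fin b) := {a | ∃ j, f (some (a, j)) ∈ Set.range g}
  have hS : S.card ≤ 2 := by
    by_contra! h
    obtain ⟨a₀, h₀, a₁, h₁, a₂, h₂, h₀₁, h₀₂, h₁₂⟩ := Finset.two_lt_card.1 h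
    refine hne (hf.centre_eq hU hg (a := ![a₀, a₁, a₂]) ?_ ?_)
    · intro i k hik
      fin_cases i <;> fin_cases k <;> simp_all
    · intro i
      fin_cases i
      · exact (Finset.mem_filter.1 h₀).2
      · exact (Finset.mem_filter.1 h₁).2
      · exact (Finset.mem_filter.1 h₂).2
  have hsub : Set.range f ∩ Set.range g ⊆
      ((Finset.insertNone (S ×ˢ Finset.univ)).image f : Finset W) := by
    rintro _ ⟨⟨x, rfl⟩, hx⟩
    refine Finset.mem_coe.2 (Finset.mem_image_of_mem f ?_)
    rcases x with _ | ⟨a, j⟩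
    · simp
    · simpa [S] using ⟨j, hx⟩
  calc (Set.range f ∩ Set.range g).ncard ≤ _ := Set.ncard_le_ncard hsub (Finset.finite_toSet _)
    _ ≤ (Finset.insertNone (S ×ˢ (Finset.univ : Finset (Fin l)))).card := by
      rw [Set.ncard_coe_finset]
      exact Finset.card_image_le
    _ ≤ 2 * l + 1 := by
      rw [Finset.card_insertNone, Finset.card_product, Finset.card_fin]
      gcongr

/-- Two stars with the same centre share only vertices on the branches of the first within the
reach of the second. -/
lemma IsStarCopy.ncard_inter_le_of_eq {f : Option (Fin b × Fin l) → W}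
    {g : Option (Fin b' × Fin l') → W} (hf : IsStarCopy U f) (hg : IsStarCopy U g)
    (heq : f none = g none) : (Set.range f ∩ Set.range g).ncard ≤ b * l' + 1 := by
  classical
  let S : Finset (Fin l) := {j | (j : ℕ) < l'}
  have hS : S.card ≤ l' := by
    simpa using Finset.card_le_card_of_injOn (t := Finset.range l') (fun j : Fin l => (j : ℕ))
      (fun j hj => by simpa [S] using hj) (Fin.val_injective.injOn (s := (S : Set (Fin l))))
  have hsub : Set.range f ∩ Set.range g ⊆
      ((Finset.insertNone (Finset.univ ×ˢ S)).image f : Finset W) := by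
    rintro _ ⟨⟨x, rfl⟩, ⟨y, hy⟩⟩
    refine Finset.mem_coe.2 (Finset.mem_image_of_mem f ?_)
    rcases x with _ | ⟨a, j⟩
    · simp
    · have h : starHeight y = j + 1 := by
        rw [← starDist_none_left, ← hg, hy, ← heq, hf]
        rfl
      have hj : (j : ℕ) < l' := by
        rcases y with _ | ⟨a', j'⟩ <;> simp only [starHeight] at h <;> omega
      simpa [S] using hj
  calc (Set.range f ∩ Set.range g).ncard ≤ _ := Set.ncard_le_ncard hsub (Finset.finite_toSet _)
    _ ≤ (Finset.insertNone ((Finset.univ : Finset (Fin b)) ×ˢ S)).card := by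
      rw [Set.ncard_coe_finset]
      exact Finset.card_image_le
    _ ≤ b * l' + 1 := by
      rw [Finset.card_insertNone, Finset.card_product, Finset.card_fin]
      gcongr

end StarCopies

end SimpleGraph

namespace ThreeTrees

open SimpleGraph

variable {W : Type*} {U : SimpleGraph W} {t : ℕ}

/-- Copies of stars of different types share few vertices: with the same centre, the type with
fewer branches bounds their number and the other type bounds their length; with different centres,
two branches of the star with the shorter branches contain the intersection. -/
lemma ncard_inter_le_of_type_ne (ht : 3 ≤ t) (hU : U.IsTree) {i j : Fin 3} (hij : i ≠ j)
    {f : StarVertex t i → W} {g : StarVertex t j → W} (hf : IsStarCopy U f)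
    (hg : IsStarCopy U g) : (Set.range f ∩ Set.range g).ncard ≤ t ^ 2 + 1 := by
  wlog h : i < j generalizing i j
  · rw [Set.inter_comm]
    exact this hij.symm hg hf (lt_of_le_of_ne (not_lt.1 h) hij.symm)
  rw [Fin.lt_def] at h
  have hj := j.2
  by_cases heq : f none = g none
  · refine (hf.ncard_inter_le_of_eq hg heq).trans ?_
    rw [← pow_add]
    gcongr
    · omega
    · omega
  · rw [Set.inter_comm]
    refine (hg.ncard_inter_le_of_ne hU hf (Ne.symm heq)).trans ?_
    have : t ^ (3 - ((j : ℕ) + 1)) ≤ t ^ 1 := Nat.pow_le_pow_right (by omega) (by omega)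
    nlinarith

lemma ncard_inter_le_of_centre_ne (ht : 1 ≤ t) (hU : U.IsTree) {i : Fin 3}
    {f g : StarVertex t i → W} (hf : IsStarCopy U f) (hg : IsStarCopy U g)
    (hne : f none ≠ g none) : (Set.range f ∩ Set.range g).ncard ≤ 2 * t ^ 2 + 1 := by
  refine (hf.ncard_inter_le_of_ne hU hg hne).trans ?_
  gcongr
  omega

/-- A tree containing the three trees `T_{k+1}` contains two copies of a star of the same type with
different centres, as otherwise the three centres would form a triangle. -/
lemma exists_star_copies (hU : U.IsTree) (h : IsIsometricUniversal (tree t) U) :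
    ∃ A : (k : Fin 3) → StarVertex t k → W, (∀ k, IsStarCopy U (A k)) ∧
      ∃ (k : Fin 3) (B : StarVertex t k → W), IsStarCopy U B ∧ B none ≠ A k none := by
  choose f hf using h.exists_edist
  have hd : ∀ k x y, U.dist (f k x) (f k y) = doubleStarDist x y := fun k x y => by
    rw [SimpleGraph.dist, hf, tree_eq_doubleStar, doubleStar_edist, ENat.toNat_natCast]
  refine ⟨fun k x => f k (Sum.inl x), fun k x y => hd k _ _, ?_⟩
  by_contra! hB
  have hc : ∀ k, f k (Sum.inr none) = f (k + 1) (Sum.inl none) := fun k =>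
    hB (k + 1) (fun x => f k (Sum.inr x)) fun x y => hd k _ _
  have hadj : ∀ k, U.Adj (f k (Sum.inl none)) (f (k + 1) (Sum.inl none)) := fun k => by
    rw [← hc, ← dist_eq_one_iff_adj, hd]
    rfl
  exact hU.isAcyclic.not_triangle (hadj 0) (hadj 1) (hadj 2)

/-- Stars of types `1`, `2` and `3` and a second star of one of these types, which pairwise share
few vertices, have more than `3 (t ^ 3 + 1)` vertices in total. -/
lemma lt_card_of_isTree [Finite W] (ht : 9 ≤ t) (hU : U.IsTree)
    (h : IsIsometricUniversal (tree t) U) : 3 * (t ^ 3 + 1) < Nat.card W := by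
  obtain ⟨A, hA, k, B, hB, hne⟩ := exists_star_copies hU h
  have hcard : ∀ (i : Fin 3) (f : StarVertex t i → W), IsStarCopy U f →
      (Set.range f).ncard = t ^ 3 + 1 := fun i f hf => by
    rw [hf.ncard_range, ← pow_add]
    congr 2
    omega
  have hBA : ∀ i, (Set.range B ∩ Set.range (A i)).ncard ≤
      (t ^ 2 + 1) + if k = i then t ^ 2 else 0 := by
    intro i
    split_ifs with hi
    · subst hi
      have := ncard_inter_le_of_centre_ne (by omega) hU hB (hA k) hne
      omega
    · simpa using ncard_inter_le_of_type_ne (by omega) hU hi hB (hA i)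
  have hBsum : ∑ i, (Set.range B ∩ Set.range (A i)).ncard ≤ 3 * (t ^ 2 + 1) + t ^ 2 := by
    refine (Finset.sum_le_sum fun i _ => hBA i).trans ?_
    simp [Finset.sum_add_distrib]
  rw [Fin.sum_univ_three] at hBsum
  have h₀₁ := ncard_inter_le_of_type_ne (by omega) hU (show (0 : Fin 3) ≠ 1 by decide) (hA 0) (hA 1)
  have h₀₂ := ncard_inter_le_of_type_ne (by omega) hU (show (0 : Fin 3) ≠ 2 by decide) (hA 0) (hA 2)
  have h₁₂ := ncard_inter_le_of_type_ne (by omega) hU (show (1 : Fin 3) ≠ 2 by decide) (hA 1) (hA 2)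
  have c₀ := hcard 0 _ (hA 0)
  have c₁ := hcard 1 _ (hA 1)
  have c₂ := hcard 2 _ (hA 2)
  have c := hcard k _ hB
  generalize Set.range (A 0) = X at *
  generalize Set.range (A 1) = Y at *
  generalize Set.range (A 2) = Z at *
  generalize Set.range B = V at *
  -- Inclusion and exclusion up to pairs, adding one set at a time.
  have e₁ := Set.ncard_union_add_ncard_inter X Y
  have e₂ := Set.ncard_union_add_ncard_inter Z (X ∪ Y)
  have e₃ := Set.ncard_union_add_ncard_inter V (Z ∪ (X ∪ Y))
  have i₂ : (Z ∩ (X ∪ Y)).ncard ≤ (X ∩ Z).ncard + (Y ∩ Z).ncard := by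
    rw [Set.inter_comm, Set.union_inter_distrib_right]
    exact Set.ncard_union_le _ _
  have i₃ : (V ∩ (Z ∪ (X ∪ Y))).ncard ≤ (V ∩ Z).ncard + ((V ∩ X).ncard + (V ∩ Y).ncard) := by
    rw [Set.inter_union_distrib_left, Set.inter_union_distrib_left]
    exact (Set.ncard_union_le _ _).trans (Nat.add_le_add_left (Set.ncard_union_le _ _) _)
  have hW : (V ∪ (Z ∪ (X ∪ Y))).ncard ≤ Nat.card W := Set.ncard_le_card _
  have hcube : 9 * t ^ 2 ≤ t ^ 3 := by
    rw [pow_succ' t 2]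
    gcongr
  have hsq : 81 ≤ t ^ 2 := by nlinarith
  omega

end ThreeTrees

theorem theorem5 (t : ℕ) (ht : 9 ≤ t) :
    -- each of the three graphs is a tree with `2 t ^ 3 + 2` vertices and pathwidth two
    (∀ k : Fin 3, (ThreeTrees.tree t k).IsTree ∧
      Nat.card (ThreeTrees.StarVertex t k ⊕ ThreeTrees.StarVertex t (k + 1)) = 2 * t ^ 3 + 2 ∧
      (ThreeTrees.tree t k).pathwidth = 2) ∧
    -- the three stars with a triangle on their centres are isometric-universal for the trees
    (SimpleGraph.IsIsometricUniversal (ThreeTrees.tree t) (ThreeTrees.triangleOfStars t) ∧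
      Nat.card (Σ k : Fin 3, ThreeTrees.StarVertex t k) = 3 * (t ^ 3 + 1)) ∧
    -- every isometric-universal tree has more vertices, and so is not minimum
    (∀ (W : Type*) [Finite W] (U : SimpleGraph W), U.IsTree →
      SimpleGraph.IsIsometricUniversal (ThreeTrees.tree t) U →
        3 * (t ^ 3 + 1) < Nat.card W ∧
        ¬ SimpleGraph.IsMinimumIsometricUniversal (ThreeTrees.tree t) U) := by
  have hcard : Nat.card (Σ k : Fin 3, ThreeTrees.StarVertex t k) = 3 * (t ^ 3 + 1) := by
    rw [Nat.card_sigma, Finset.sum_congr rfl fun k _ => ThreeTrees.card_starVertex t k]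
    simp
  refine ⟨fun k => ⟨SimpleGraph.doubleStar_isTree _ _ _ _, ?_,
    ThreeTrees.tree_pathwidth (by omega) k⟩,
    ⟨ThreeTrees.isIsometricUniversal_triangleOfStars t, hcard⟩, fun W _ U hU h => ?_⟩
  · rw [Nat.card_sum, ThreeTrees.card_starVertex, ThreeTrees.card_starVertex]
    ring
  · have hlt := ThreeTrees.lt_card_of_isTree ht hU h
    exact ⟨hlt, fun hmin => hlt.not_ge (hcard ▸
      hmin.2 _ _ (ThreeTrees.isIsometricUniversal_triangleOfStars t))⟩
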